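/- Write $e(t)=e^{2\pi i t}$, $B(0,R)=\{x\in\mathbb R^d:|x|\le R\}$, and $\widehat{\sigma}(x)=\int_{\mathbb R^d} e(\xi\cdot x)\,d\sigma(\xi)$ for a finite Borel measure $\sigma$ on $\mathbb R^d$. Let $2\le p<\infty$ and let $E\subset\mathbb R^d$ be compact. For $c,C,K>0$ and $R>0$, say that a finite set $\mathcal P\subset E$ is $(c,C,K)$-tight at scale $R$ if $$c\,R^{2d/p}\le |\mathcal P|\le C\,R^{2d/p}\qquad\text{and}\qquad \frac1{|B(0,R)|}\int_{B(0,R)}\Big|\sum_{\xi\in\mathcal P}e(\xi\cdot x)\Big|^p\,dx\le K\,|\mathcal P|^{p/2}.$$ (1) Let $\sigma$ be a Borel probability measure on $\mathbb R^d$ with $\operatorname{supp}\sigma\subset E$ and $\int_{\mathbb R^d}|\widehat{\sigma}(x)|^p\,dx<\infty$, such that for each $\varepsilon>0$ there is a finite partition of $\operatorname{supp}\sigma$ into Borel sets of equal $\sigma$-measure and of diameter less than $\varepsilon$. Then there are constants $c,C,K,R_0>0$ (independent of $R$) such that for every $R\ge R_0$ there is a set $\mathcal P_R\subset E$ that is $(c,C,K)$-tight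 at scale $R$. (2) Conversely, if there are a sequence $R_k\to\infty$ and constants $c,C,K>0$ independent of $k$ such that for every $k$ there is a set $\mathcal P_{R_k}\subset E$ that is $(c,C,K)$-tight at scale $R_k$, then there is a Borel probability measure $\sigma$ on $\mathbb R^d$ with $\operatorname{supp}\sigma\subset E$ and $\int_{\mathbb R^d}|\widehat{\sigma}(x)|^p\,dx<\infty$. -/

import Mathlib

open MeasureTheory Metric Filter Topology
open scoped RealInnerProductSpace

namespace TightDecoupling

/-- The character `e(t) = exp(2πit)`. -/
noncomputable def e (t : ℝ) : ℂ := Complex.exp (2 * Real.pi * t * Complex.I)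

/-- The Fourier transform `x ↦ ∫ e(ξ · x) dσ(ξ)` of a measure `σ` on `ℝ^d`. -/
noncomputable def fourierMeasure {d : ℕ} (σ : Measure (EuclideanSpace ℝ (Fin d)))
    (x : EuclideanSpace ℝ (Fin d)) : ℂ :=
  ∫ ξ, e ⟪ξ, x⟫ ∂σ

/-- `E` supports the probability measure `σ`, and the Fourier transform of `σ` is in `L^p(ℝ^d)`. -/
structure SupportsWithDecay {d : ℕ} (E : Set (EuclideanSpace ℝ (Fin d))) (p : ℝ)
    (σ : Measure (EuclideanSpace ℝ (Fin d))) : Prop where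
  isProbabilityMeasure : IsProbabilityMeasure σ
  support_subset : σ.support ⊆ E
  decay : ∫⁻ x, ‖fourierMeasure σ x‖ₑ ^ p < ⊤

/-- For each `ε > 0` the support of `σ` has a finite partition into Borel sets of equal
`σ`-measure and of diameter less than `ε`. -/
def HasFineEqualPartitions {d : ℕ} (σ : Measure (EuclideanSpace ℝ (Fin d))) : Prop :=
  ∀ ε : ℝ, 0 < ε → ∃ (N : ℕ) (S : Fin N → Set (EuclideanSpace ℝ (Fin d))),
    (∀ n, MeasurableSet (S n)) ∧
    Pairwise (fun m n => Disjoint (S m) (S n)) ∧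
    (⋃ n, S n) = σ.support ∧
    (∀ m n, σ (S m) = σ (S n)) ∧
    (∀ n, ediam (S n) < ENNReal.ofReal ε)

/-- The exponential sum `x ↦ ∑_{ξ ∈ P} a_ξ e(ξ · x)`. -/
noncomputable def expSum {d : ℕ} (P : Finset (EuclideanSpace ℝ (Fin d)))
    (a : EuclideanSpace ℝ (Fin d) → ℂ) (x : EuclideanSpace ℝ (Fin d)) : ℂ :=
  ∑ ξ ∈ P, a ξ * e ⟪ξ, x⟫

/-- Square root cancellation in `L^p` on `B(0,R) = {|x| ≤ R}`, with constant `K`: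
`|B(0,R)|⁻¹ ∫_{B(0,R)} |∑_{ξ ∈ P} a_ξ e(ξ · x)|^p dx ≤ K ‖a‖_{ℓ²(P)}^p`. -/
def SqrtCancellation {d : ℕ} (p R K : ℝ) (P : Finset (EuclideanSpace ℝ (Fin d)))
    (a : EuclideanSpace ℝ (Fin d) → ℂ) : Prop :=
  ⨍ x in closedBall (0 : EuclideanSpace ℝ (Fin d)) R, ‖expSum P a x‖ ^ p
    ≤ K * √(∑ ξ ∈ P, ‖a ξ‖ ^ 2) ^ p

/-- At scale `R` there is a finite set `P ⊆ E` with `c R^{2d/p} ≤ |P| ≤ C R^{2d/p}` whose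
exponential sum with coefficients `a_ξ ≡ 1` has square root cancellation with constant `K`. -/
def HasTightPoints {d : ℕ} (E : Set (EuclideanSpace ℝ (Fin d))) (p c C K R : ℝ) : Prop :=
  ∃ P : Finset (EuclideanSpace ℝ (Fin d)), (P : Set (EuclideanSpace ℝ (Fin d))) ⊆ E ∧
    c * R ^ (2 * (d : ℝ) / p) ≤ (P.card : ℝ) ∧
    (P.card : ℝ) ≤ C * R ^ (2 * (d : ℝ) / p) ∧
    SqrtCancellation p R K P (fun _ => 1)

end TightDecoupling

namespace TightDecoupling

/-! Both directions compare the exponential sum over `P` with `N σ̂`, where `N = |P| ~ R^{2d/p}`.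
This exponent is the one for which `N^p` and `N^{p/2} R^d` have the same order.

From measure to points: draw `N` independent points from `σ`. At each `x` the sum is `N σ̂(x)` plus
a centred sum of bounded independent variables, whose `p`-th moment is `O(N^{p/2})` by subgaussian
concentration. The bias contributes at most `N^p ∫ |σ̂|^p ≲ N^{p/2} R^d` on the ball, so some sample
is tight (`exists_finset_lintegral_expSum_sub_le`). Distinctness of the points costs nothing,
because decay forbids atoms when `d ≥ 1` (`measure_singleton_eq_zero_of_decay`).

From points to measure: tightness says exactly that the normalized counting measures have Fourier
transforms bounded in `L^p(B(0,R_k))` uniformly in `k`. Compactness of `E` gives a weak limit point,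
and Fatou's lemma passes the bound to it. -/

lemma norm_e (t : ℝ) : ‖e t‖ = 1 := by
  have : e t = Complex.exp ((2 * Real.pi * t : ℝ) * Complex.I) := by
    simp [e]
  rw [this, Complex.norm_exp_ofReal_mul_I]

@[fun_prop]
lemma continuous_e : Continuous e := by
  unfold e
  fun_prop

/-! ### Continuity, and square root cancellation as a bound on a `lintegral`. -/

variable {d : ℕ}

lemma integrable_e_inner (σ : Measure (EuclideanSpace ℝ (Fin d))) [IsFiniteMeasure σ]
    (x : EuclideanSpace ℝ (Fin d)) : Integrable (fun ξ => e ⟪ξ, x⟫) σ :=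
  Integrable.of_bound (by fun_prop) 1 (by simp [norm_e])

lemma continuous_fourierMeasure (σ : Measure (EuclideanSpace ℝ (Fin d))) [IsFiniteMeasure σ] :
    Continuous (fourierMeasure σ) := by
  unfold fourierMeasure
  refine continuous_of_dominated (bound := fun _ => 1) (fun x => ?_) (fun x => ?_) ?_ ?_
  · exact (integrable_e_inner σ x).aestronglyMeasurable
  · simp [norm_e]
  · exact integrable_const _
  · exact .of_forall fun ξ => by fun_prop

lemma continuous_expSum (P : Finset (EuclideanSpace ℝ (Fin d)))
    (a : EuclideanSpace ℝ (Fin d) → ℂ) : Continuous (expSum P a) := by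
  unfold expSum
  fun_prop

lemma setLIntegral_rpow_enorm_le_iff {f : EuclideanSpace ℝ (Fin d) → ℂ} (hf : Continuous f)
    {p R B : ℝ} (hp : 0 ≤ p) (hR : 0 < R) (hB : 0 ≤ B) :
    ∫⁻ x in closedBall (0 : EuclideanSpace ℝ (Fin d)) R, ‖f x‖ₑ ^ p ≤
        ENNReal.ofReal B * volume (closedBall (0 : EuclideanSpace ℝ (Fin d)) R) ↔
      ⨍ x in closedBall (0 : EuclideanSpace ℝ (Fin d)) R, ‖f x‖ ^ p ≤ B := by
  have hint : IntegrableOn (fun x => ‖f x‖ ^ p) (closedBall 0 R) :=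
    (Continuous.continuousOn (by fun_prop (disch := simp [hp]))).integrableOn_compact
      (isCompact_closedBall _ _)
  have hvol : 0 < volume (closedBall (0 : EuclideanSpace ℝ (Fin d)) R) :=
    measure_closedBall_pos _ _ hR
  have hfin : volume (closedBall (0 : EuclideanSpace ℝ (Fin d)) R) ≠ ⊤ :=
    measure_closedBall_lt_top.ne
  have hpos : 0 < volume.real (closedBall (0 : EuclideanSpace ℝ (Fin d)) R) :=
    ENNReal.toReal_pos hvol.ne' hfin
  have h1 : ∫⁻ x in closedBall (0 : EuclideanSpace ℝ (Fin d)) R, ‖f x‖ₑ ^ p =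
      ENNReal.ofReal (∫ x in closedBall (0 : EuclideanSpace ℝ (Fin d)) R, ‖f x‖ ^ p) := by
    rw [ofReal_integral_eq_lintegral_ofReal hint (.of_forall fun x => by positivity)]
    refine lintegral_congr fun x => ?_
    rw [← ENNReal.ofReal_rpow_of_nonneg (norm_nonneg _) hp, ofReal_norm]
  rw [h1, ← ENNReal.ofReal_toReal hfin, ← ENNReal.ofReal_mul hB,
    ENNReal.ofReal_le_ofReal_iff (by positivity), setAverage_eq, smul_eq_mul,
    inv_mul_le_iff₀ hpos, mul_comm B]
  rfl

lemma sqrtCancellation_one_iff (P : Finset (EuclideanSpace ℝ (Fin d)))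
    {p R K : ℝ} (hp : 0 ≤ p) (hR : 0 < R) (hK : 0 ≤ K) :
    SqrtCancellation p R K P (fun _ => 1) ↔
      ∫⁻ x in closedBall (0 : EuclideanSpace ℝ (Fin d)) R, ‖expSum P (fun _ => 1) x‖ₑ ^ p ≤
        ENNReal.ofReal (K * (P.card : ℝ) ^ (p / 2)) *
          volume (closedBall (0 : EuclideanSpace ℝ (Fin d)) R) := by
  rw [setLIntegral_rpow_enorm_le_iff (continuous_expSum P _) hp hR (by positivity)]
  have : √(∑ ξ ∈ P, ‖(1 : ℂ)‖ ^ 2) ^ p = (P.card : ℝ) ^ (p / 2) := by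
    simp only [norm_one, one_pow, Finset.sum_const, nsmul_eq_mul, mul_one]
    rw [Real.sqrt_eq_rpow, ← Real.rpow_mul (by positivity)]
    ring_nf
  rw [SqrtCancellation, this]

/-! ### Tight sets to measure: empirical measures and weak limits. -/

/-- The normalized counting measure on a finite set of frequencies. -/
noncomputable def empiricalMeasure (P : Finset (EuclideanSpace ℝ (Fin d))) :
    Measure (EuclideanSpace ℝ (Fin d)) :=
  (P.card : ENNReal)⁻¹ • ∑ ξ ∈ P, Measure.dirac ξ

lemma isProbabilityMeasure_empiricalMeasure {P : Finset (EuclideanSpace ℝ (Fin d))}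
    (hP : P.Nonempty) : IsProbabilityMeasure (empiricalMeasure P) := by
  constructor
  simp only [empiricalMeasure, Measure.smul_apply, Measure.coe_finsetSum, Finset.sum_apply,
    measure_univ, Finset.sum_const, nsmul_eq_mul, mul_one, smul_eq_mul]
  exact ENNReal.inv_mul_cancel (by simpa using hP.ne_empty) (by simp)

lemma empiricalMeasure_compl_eq_zero {P : Finset (EuclideanSpace ℝ (Fin d))}
    {E : Set (EuclideanSpace ℝ (Fin d))} (hE : MeasurableSet E) (hPE : (P : Set _) ⊆ E) :
    empiricalMeasure P Eᶜ = 0 := by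
  simp only [empiricalMeasure, Measure.smul_apply, Measure.coe_finsetSum, Finset.sum_apply,
    smul_eq_mul, mul_eq_zero]
  right
  refine Finset.sum_eq_zero fun ξ hξ => ?_
  rw [Measure.dirac_apply' _ hE.compl]
  simp [hPE hξ]

lemma fourierMeasure_empiricalMeasure (P : Finset (EuclideanSpace ℝ (Fin d)))
    (x : EuclideanSpace ℝ (Fin d)) :
    fourierMeasure (empiricalMeasure P) x = (P.card : ℂ)⁻¹ * expSum P (fun _ => 1) x := by
  rw [fourierMeasure, empiricalMeasure, integral_smul_measure,
    integral_finsetSum_measure fun ξ _ => integrable_e_inner _ x]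
  simp [expSum]

/-- Fatou's lemma for the Fourier transforms of a weakly convergent sequence on growing balls. -/
lemma lintegral_fourierMeasure_le_of_tendsto
    {σ : ℕ → ProbabilityMeasure (EuclideanSpace ℝ (Fin d))}
    {τ : ProbabilityMeasure (EuclideanSpace ℝ (Fin d))} (hσ : Tendsto σ atTop (𝓝 τ))
    {R : ℕ → ℝ} (hR : Tendsto R atTop atTop) {p : ℝ} {M : ENNReal}
    (hM : ∀ᶠ k in atTop, ∫⁻ x in closedBall (0 : EuclideanSpace ℝ (Fin d)) (R k),
      ‖fourierMeasure (σ k : Measure (EuclideanSpace ℝ (Fin d))) x‖ₑ ^ p ≤ M) :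
    ∫⁻ x, ‖fourierMeasure (τ : Measure (EuclideanSpace ℝ (Fin d))) x‖ₑ ^ p ≤ M := by
  have hlim : ∀ x, Tendsto (fun k => fourierMeasure (σ k : Measure (EuclideanSpace ℝ (Fin d))) x) atTop
      (𝓝 (fourierMeasure (τ : Measure (EuclideanSpace ℝ (Fin d))) x)) := by
    intro x
    rw [ProbabilityMeasure.tendsto_iff_forall_integral_rclike_tendsto ℂ] at hσ
    exact hσ (BoundedContinuousFunction.ofNormedAddCommGroup (fun ξ => e ⟪ξ, x⟫)
      (by fun_prop) 1 (by simp [norm_e]))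
  have hlim' : ∀ x, Tendsto (fun k => (closedBall (0 : EuclideanSpace ℝ (Fin d)) (R k)).indicator
      (fun x => ‖fourierMeasure (σ k : Measure (EuclideanSpace ℝ (Fin d))) x‖ₑ ^ p) x) atTop
      (𝓝 (‖fourierMeasure (τ : Measure (EuclideanSpace ℝ (Fin d))) x‖ₑ ^ p)) := by
    intro x
    have h2 : Tendsto (fun k => ‖fourierMeasure (σ k : Measure (EuclideanSpace ℝ (Fin d))) x‖ₑ ^ p) atTop
        (𝓝 (‖fourierMeasure (τ : Measure (EuclideanSpace ℝ (Fin d))) x‖ₑ ^ p)) :=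
      (ENNReal.continuous_rpow_const.tendsto _).comp ((continuous_enorm.tendsto _).comp (hlim x))
    refine h2.congr' ?_
    -- The growing balls eventually contain the fixed point `x`, so the cutoff disappears in the
    -- limit.
    filter_upwards [hR.eventually_ge_atTop ‖x‖] with k hk
    rw [Set.indicator_of_mem (by simpa using hk)]
  calc ∫⁻ x, ‖fourierMeasure (τ : Measure (EuclideanSpace ℝ (Fin d))) x‖ₑ ^ p
      = ∫⁻ x, liminf (fun k => (closedBall (0 : EuclideanSpace ℝ (Fin d)) (R k)).indicator
          (fun x => ‖fourierMeasure (σ k : Measure (EuclideanSpace ℝ (Fin d))) x‖ₑ ^ p) x) atTop :=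
        lintegral_congr fun x => (hlim' x).liminf_eq.symm
    _ ≤ liminf (fun k => ∫⁻ x, (closedBall (0 : EuclideanSpace ℝ (Fin d)) (R k)).indicator
          (fun x => ‖fourierMeasure (σ k : Measure (EuclideanSpace ℝ (Fin d))) x‖ₑ ^ p) x) atTop := by
        refine lintegral_liminf_le fun k => Measurable.indicator ?_ measurableSet_closedBall
        exact (continuous_fourierMeasure _).measurable.enorm.pow_const p
    _ ≤ M := by
        refine liminf_le_of_le (by isBoundedDefault) fun b hb => ?_
        obtain ⟨k, hk, hk'⟩ := (hb.and hM).exists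
        rw [lintegral_indicator measurableSet_closedBall] at hk
        exact hk.trans hk'

lemma volume_closedBall_zero_eq {R : ℝ} (hR : 0 ≤ R) :
    volume (closedBall (0 : EuclideanSpace ℝ (Fin d)) R) =
      ENNReal.ofReal (R ^ d) * volume (closedBall (0 : EuclideanSpace ℝ (Fin d)) 1) := by
  simpa using Measure.addHaar_closedBall' volume (0 : EuclideanSpace ℝ (Fin d)) hR

/-- The `L^p` norms of the Fourier transforms of the empirical measures of tight sets are bounded
uniformly in the scale. -/
lemma setLIntegral_fourierMeasure_empiricalMeasure_le {P : Finset (EuclideanSpace ℝ (Fin d))}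
    {p c K R : ℝ} (hp : 0 < p) (hc : 0 < c) (hK : 0 ≤ K) (hR : 0 < R)
    (hcard : c * R ^ (2 * (d : ℝ) / p) ≤ P.card) (hP : SqrtCancellation p R K P (fun _ => 1)) :
    ∫⁻ x in closedBall (0 : EuclideanSpace ℝ (Fin d)) R,
        ‖fourierMeasure (empiricalMeasure P) x‖ₑ ^ p ≤
      ENNReal.ofReal (K * c ^ (-(p / 2))) *
        volume (closedBall (0 : EuclideanSpace ℝ (Fin d)) 1) := by
  rw [sqrtCancellation_one_iff P hp.le hR hK] at hP
  have hN : (0 : ℝ) < P.card := lt_of_lt_of_le (by positivity) hcard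
  have h1 : ∀ x, ‖fourierMeasure (empiricalMeasure P) x‖ₑ ^ p =
      ENNReal.ofReal ((P.card : ℝ) ^ (-p)) * ‖expSum P (fun _ => 1) x‖ₑ ^ p := by
    intro x
    rw [fourierMeasure_empiricalMeasure, enorm_mul, ENNReal.mul_rpow_of_nonneg _ _ hp.le,
      Real.rpow_neg hN.le, ← Real.inv_rpow hN.le,
      ← ENNReal.ofReal_rpow_of_nonneg (by positivity) hp.le, ← ofReal_norm]
    simp
  simp_rw [h1]
  rw [lintegral_const_mul' _ _ ENNReal.ofReal_ne_top]
  refine (mul_le_mul_right hP _).trans ?_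
  rw [volume_closedBall_zero_eq hR.le, ← mul_assoc, ← mul_assoc,
    ← ENNReal.ofReal_mul (by positivity), ← ENNReal.ofReal_mul (by positivity)]
  refine mul_le_mul_left (ENNReal.ofReal_le_ofReal ?_) _
  have h2 : (P.card : ℝ) ^ (-p) * (P.card : ℝ) ^ (p / 2) = (P.card : ℝ) ^ (-(p / 2)) := by
    rw [← Real.rpow_add hN]; ring_nf
  have h3 : (P.card : ℝ) ^ (-(p / 2)) ≤ (c * R ^ (2 * (d : ℝ) / p)) ^ (-(p / 2)) :=
    Real.rpow_le_rpow_of_nonpos (by positivity) hcard (by linarith)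
  -- The lower bound on `|P|` is worth exactly `R^{-d}`, which cancels the volume of the ball.
  have h4 : (c * R ^ (2 * (d : ℝ) / p)) ^ (-(p / 2)) * R ^ d = c ^ (-(p / 2)) := by
    rw [Real.mul_rpow hc.le (by positivity), ← Real.rpow_mul hR.le, mul_assoc,
      ← Real.rpow_natCast R d, ← Real.rpow_add hR]
    have : 2 * (d : ℝ) / p * -(p / 2) + d = 0 := by field_simp; ring
    rw [this, Real.rpow_zero, mul_one]
  calc (P.card : ℝ) ^ (-p) * (K * (P.card : ℝ) ^ (p / 2)) * R ^ d
      = K * ((P.card : ℝ) ^ (-(p / 2)) * R ^ d) := by rw [← h2]; ring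
    _ ≤ K * ((c * R ^ (2 * (d : ℝ) / p)) ^ (-(p / 2)) * R ^ d) := by gcongr
    _ = K * c ^ (-(p / 2)) := by rw [h4]

lemma exists_supportsWithDecay_of_hasTightPoints {E : Set (EuclideanSpace ℝ (Fin d))}
    (hE : IsCompact E) {p : ℝ} (hp : 0 < p) {R : ℕ → ℝ} (hR : Tendsto R atTop atTop)
    {c C K : ℝ} (hc : 0 < c) (hK : 0 ≤ K) (h : ∀ k, HasTightPoints E p c C K (R k)) :
    ∃ σ : Measure (EuclideanSpace ℝ (Fin d)), SupportsWithDecay E p σ := by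
  obtain ⟨k₀, hk₀⟩ := eventually_atTop.1 (hR.eventually_gt_atTop 0)
  choose P hPE hcard _ hsq using h
  -- The shift by `k₀` makes every scale positive, which the lower cardinality bound needs to force
  -- nonemptiness.
  have hne : ∀ k, (P (k + k₀)).Nonempty := fun k => by
    rw [← Finset.card_pos, ← Nat.cast_pos (α := ℝ)]
    have := hk₀ (k + k₀) (by omega)
    exact lt_of_lt_of_le (by positivity) (hcard _)
  let σ : ℕ → ProbabilityMeasure (EuclideanSpace ℝ (Fin d)) := fun k =>
    ⟨empiricalMeasure (P (k + k₀)), isProbabilityMeasure_empiricalMeasure (hne k)⟩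
  -- Prokhorov with the constant compact set `E` and zero mass allowed outside it, so the limit also
  -- lives on `E`.
  have hcomp := isCompact_setOfPred_probabilityMeasure_mass_eq_compl_isCompact_le
    (u := fun _ => 0) (K := fun _ => E) tendsto_const_nhds (fun _ => hE) (Or.inl inferInstance)
  obtain ⟨τ, hτ, φ, hφ, hlim⟩ := hcomp.tendsto_subseq (x := σ) (fun k _ => by
    rw [nonpos_iff_eq_zero, ProbabilityMeasure.null_iff_toMeasure_null]
    exact empiricalMeasure_compl_eq_zero hE.measurableSet (hPE _))
  refine ⟨τ, inferInstance, ?_, ?_⟩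
  · have := hτ 0
    rw [nonpos_iff_eq_zero, ProbabilityMeasure.null_iff_toMeasure_null] at this
    exact Measure.support_subset_of_isClosed hE.isClosed this
  · refine lt_of_le_of_lt (lintegral_fourierMeasure_le_of_tendsto hlim
      (R := fun k => R (φ k + k₀))
      (hR.comp ((tendsto_add_atTop_nat k₀).comp hφ.tendsto_atTop)) (.of_forall fun k =>
        setLIntegral_fourierMeasure_empiricalMeasure_le hp hc hK (hk₀ _ (by omega))
          (hcard _) (hsq _))) ?_
    exact ENNReal.mul_lt_top ENNReal.ofReal_lt_top measure_closedBall_lt_top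

/-! ### Decay excludes atoms. -/

/-- Testing `σ̂` against a modulated Gaussian bounds the mass of an atom of `σ`. -/
lemma gaussian_mul_measureReal_singleton_le (σ : Measure (EuclideanSpace ℝ (Fin d)))
    [IsFiniteMeasure σ] (ξ₀ : EuclideanSpace ℝ (Fin d)) {b : ℝ} (hb : 0 < b) :
    (Real.pi / b) ^ ((d : ℝ) / 2) * σ.real {ξ₀} ≤
      ∫ x, ‖fourierMeasure σ x‖ * Real.exp (-b * ‖x‖ ^ 2) := by
  have hb' : 0 < (b : ℂ).re := by simpa
  have hG : Integrable (fun x : EuclideanSpace ℝ (Fin d) => Real.exp (-b * ‖x‖ ^ 2)) := by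
    have h := (GaussianFourier.integrable_cexp_neg_mul_sq_norm_add hb' 0
      (0 : EuclideanSpace ℝ (Fin d))).norm
    simpa [Complex.norm_exp, ← Complex.ofReal_pow] using h
  -- Fubini for this kernel: integration in `x` gives a Gaussian bump at `ξ₀`, integration in `ξ`
  -- gives the modulated, damped `σ̂`.
  set F : EuclideanSpace ℝ (Fin d) → EuclideanSpace ℝ (Fin d) → ℂ := fun x ξ =>
    e ⟪ξ, x⟫ * (e (-⟪ξ₀, x⟫) * Real.exp (-b * ‖x‖ ^ 2)) with hF
  have hFcont : Continuous (Function.uncurry F) := by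
    simp only [hF, Function.uncurry_def]
    fun_prop
  have hFint : Integrable (Function.uncurry F) (volume.prod σ) := by
    refine Integrable.mono' (hG.mul_prod (integrable_const (1 : ℝ)))
      hFcont.aestronglyMeasurable (.of_forall fun z => ?_)
    simp [F, Function.uncurry, norm_e, -Complex.ofReal_mul,
      -Complex.ofReal_neg]
  have hinner : ∀ ξ, ∫ x, F x ξ = (((Real.pi / b) ^ ((d : ℝ) / 2) *
      Real.exp (-(Real.pi ^ 2 * ‖ξ - ξ₀‖ ^ 2 / b)) : ℝ) : ℂ) := by
    intro ξ
    have h := GaussianFourier.integral_cexp_neg_mul_sq_norm_add hb' (2 * Real.pi * Complex.I)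
      (ξ - ξ₀)
    have h1 : ∀ x, F x ξ =
        Complex.exp (-(b : ℂ) * ‖x‖ ^ 2 + 2 * Real.pi * Complex.I * ⟪ξ - ξ₀, x⟫) := by
      intro x
      simp only [hF, e, Complex.ofReal_exp, ← Complex.exp_add, inner_sub_left]
      congr 1
      push_cast
      ring
    simp_rw [h1]
    rw [h, finrank_euclideanSpace_fin, Complex.ofReal_mul,
      Complex.ofReal_cpow (by positivity), Complex.ofReal_exp]
    congr 2
    · push_cast; rfl
    · push_cast; rfl
    · push_cast
      have : (b : ℂ) ≠ 0 := by exact_mod_cast hb.ne'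
      field_simp
      rw [Complex.I_sq]
      ring
  have houter : ∀ x, ∫ ξ, F x ξ ∂σ =
      fourierMeasure σ x * (e (-⟪ξ₀, x⟫) * Real.exp (-b * ‖x‖ ^ 2)) := fun x => by
    simp only [hF, integral_mul_const, fourierMeasure]
  have hswap := integral_integral_swap hFint
  simp_rw [hinner, houter] at hswap
  rw [integral_complex_ofReal, integral_const_mul] at hswap
  -- The bump is positive and equals `1` at `ξ₀`, so it dominates the indicator of `{ξ₀}`.
  have hlow : σ.real {ξ₀} ≤ ∫ ξ, Real.exp (-(Real.pi ^ 2 * ‖ξ - ξ₀‖ ^ 2 / b)) ∂σ := by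
    rw [← integral_indicator_one (measurableSet_singleton ξ₀)]
    refine integral_mono ((integrable_const 1).indicator (measurableSet_singleton ξ₀))
      (Integrable.of_bound (by fun_prop) 1 (.of_forall fun ξ => ?_)) fun ξ => ?_
    · rw [Real.norm_eq_abs, Real.abs_exp, Real.exp_le_one_iff]
      simp only [Left.neg_nonpos_iff]
      positivity
    · by_cases h : ξ = ξ₀
      · simp [h]
      · simp only [Set.mem_singleton_iff, h, not_false_eq_true, Set.indicator_of_notMem]
        positivity
  calc (Real.pi / b) ^ ((d : ℝ) / 2) * σ.real {ξ₀}
      ≤ (Real.pi / b) ^ ((d : ℝ) / 2) *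
          ∫ ξ, Real.exp (-(Real.pi ^ 2 * ‖ξ - ξ₀‖ ^ 2 / b)) ∂σ := by gcongr
    _ ≤ ‖∫ x, fourierMeasure σ x * (e (-⟪ξ₀, x⟫) * Real.exp (-b * ‖x‖ ^ 2))‖ := by
        rw [hswap, Complex.norm_real]
        exact le_abs_self _
    _ ≤ ∫ x, ‖fourierMeasure σ x * (e (-⟪ξ₀, x⟫) * Real.exp (-b * ‖x‖ ^ 2))‖ :=
        norm_integral_le_integral_norm _
    _ = ∫ x, ‖fourierMeasure σ x‖ * Real.exp (-b * ‖x‖ ^ 2) := by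
        refine integral_congr_ae (.of_forall fun x => ?_)
        simp only [norm_mul, norm_e, one_mul, Complex.norm_real, Real.norm_eq_abs, Real.abs_exp]

/-- Splits `|σ̂|` into a small constant and an integrable part, in place of Hölder's inequality. -/
lemma le_add_rpow_mul_rpow {t ε p : ℝ} (ht : 0 ≤ t) (hε : 0 < ε) (hp : 1 ≤ p) :
    t ≤ ε + ε ^ (1 - p) * t ^ p := by
  rcases le_or_gt t ε with h | h
  · have : 0 ≤ ε ^ (1 - p) * t ^ p := by positivity
    linarith
  · have ht' : 0 < t := hε.trans h
    have h1 : t ^ (1 - p) ≤ ε ^ (1 - p) :=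
      Real.rpow_le_rpow_of_nonpos hε h.le (by linarith)
    have h2 : t = t ^ (1 - p) * t ^ p := by
      rw [← Real.rpow_add ht']; simp
    nlinarith [mul_le_mul_of_nonneg_right h1 (Real.rpow_nonneg ht p)]

/-- A finite measure on `ℝ^d`, `d ≥ 1`, with Fourier transform in `L^p`, `p < ∞`, has no atoms. -/
lemma measure_singleton_eq_zero_of_decay (hd : 0 < d) (σ : Measure (EuclideanSpace ℝ (Fin d)))
    [IsFiniteMeasure σ] {p : ℝ} (hp : 1 ≤ p)
    (hσ : ∫⁻ x, ‖fourierMeasure σ x‖ₑ ^ p < ⊤) (ξ₀ : EuclideanSpace ℝ (Fin d)) :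
    σ {ξ₀} = 0 := by
  have hcont := continuous_fourierMeasure σ
  have hint : Integrable (fun x => ‖fourierMeasure σ x‖ ^ p) := by
    refine ⟨(hcont.norm.rpow_const fun _ => .inr (by linarith)).aestronglyMeasurable, ?_⟩
    rw [hasFiniteIntegral_iff_ofReal (.of_forall fun _ => by positivity)]
    refine lt_of_eq_of_lt (lintegral_congr fun x => ?_) hσ
    rw [← ENNReal.ofReal_rpow_of_nonneg (norm_nonneg _) (by linarith), ofReal_norm]
  by_contra hne
  have hm : 0 < σ.real {ξ₀} := ENNReal.toReal_pos hne (measure_ne_top _ _)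
  set m := σ.real {ξ₀}
  set A := ∫ x, ‖fourierMeasure σ x‖ ^ p
  have hA : 0 ≤ A := integral_nonneg fun x => by positivity
  -- With this choice the `ε` term absorbs only half of the atom's contribution.
  set ε := m / 2 with hε
  have hε0 : 0 < ε := by positivity
  have key : ∀ b : ℝ, 0 < b → (Real.pi / b) ^ ((d : ℝ) / 2) * m ≤
      ε * (Real.pi / b) ^ ((d : ℝ) / 2) + ε ^ (1 - p) * A := by
    intro b hb
    have hG : Integrable (fun x : EuclideanSpace ℝ (Fin d) => Real.exp (-b * ‖x‖ ^ 2)) := by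
      have h := (GaussianFourier.integrable_cexp_neg_mul_sq_norm_add
        (show 0 < (b : ℂ).re by simpa) 0 (0 : EuclideanSpace ℝ (Fin d))).norm
      simpa [Complex.norm_exp, ← Complex.ofReal_pow] using h
    have hle : ∀ x : EuclideanSpace ℝ (Fin d), Real.exp (-b * ‖x‖ ^ 2) ≤ 1 := fun x => by
      rw [Real.exp_le_one_iff]
      have : 0 ≤ b * ‖x‖ ^ 2 := by positivity
      linarith
    refine (gaussian_mul_measureReal_singleton_le σ ξ₀ hb).trans ?_
    have hGint := GaussianFourier.integral_rexp_neg_mul_sq_norm (V := EuclideanSpace ℝ (Fin d)) hb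
    rw [finrank_euclideanSpace_fin] at hGint
    rw [← hGint, ← integral_const_mul, ← integral_const_mul,
      ← integral_add (hG.const_mul _) (hint.const_mul _)]
    refine integral_mono_of_nonneg (.of_forall fun x => by positivity)
      ((hG.const_mul _).add (hint.const_mul _)) (.of_forall fun x => ?_)
    have h1 := le_add_rpow_mul_rpow (norm_nonneg (fourierMeasure σ x)) hε0 hp
    have h2 : 0 ≤ ε ^ (1 - p) * ‖fourierMeasure σ x‖ ^ p := by positivity
    calc ‖fourierMeasure σ x‖ * Real.exp (-b * ‖x‖ ^ 2)
        ≤ (ε + ε ^ (1 - p) * ‖fourierMeasure σ x‖ ^ p) * Real.exp (-b * ‖x‖ ^ 2) := by gcongr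
      _ = ε * Real.exp (-b * ‖x‖ ^ 2) +
          ε ^ (1 - p) * ‖fourierMeasure σ x‖ ^ p * Real.exp (-b * ‖x‖ ^ 2) := by ring
      _ ≤ _ := by
        have := mul_le_of_le_one_right h2 (hle x)
        simpa using this
  have hT : ∀ T : ℝ, 0 < T → T * ε ≤ ε ^ (1 - p) * A := by
    intro T hT
    -- This width makes the total Gaussian mass `(π/b)^{d/2}` equal to `T`. As `T` is arbitrary, the
    -- bound by a fixed constant is absurd.
    have h := key (Real.pi / T ^ (2 / (d : ℝ))) (by positivity)
    have hd' : (d : ℝ) ≠ 0 := by positivity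
    have hT' : (Real.pi / (Real.pi / T ^ (2 / (d : ℝ)))) ^ ((d : ℝ) / 2) = T := by
      rw [div_div_cancel₀ Real.pi_ne_zero, ← Real.rpow_mul hT.le]
      have : 2 / (d : ℝ) * (d / 2) = 1 := by field_simp
      rw [this, Real.rpow_one]
    rw [hT'] at h
    have : m = 2 * ε := by rw [hε]; ring
    rw [this] at h
    linarith
  have h := hT ((ε ^ (1 - p) * A + 1) / ε) (by positivity)
  rw [div_mul_cancel₀ _ hε0.ne'] at h
  linarith

/-! ### Moments of sums of independent samples. -/

open ProbabilityTheory in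
lemma lintegral_rpow_enorm_le_of_hasSubgaussianMGF {Ω : Type*} [MeasurableSpace Ω]
    {μ : Measure Ω} {X : Ω → ℝ} {s : NNReal} (hs : 0 < s) (hX : HasSubgaussianMGF X s μ)
    {p : ℝ} (hp : 0 ≤ p) :
    ∫⁻ ω, ‖X ω‖ₑ ^ p ∂μ ≤ ENNReal.ofReal (2 * Real.exp (1 / 2) * p ^ p * (s : ℝ) ^ (p / 2)) := by
  have hs' : (0 : ℝ) < s := by exact_mod_cast hs
  -- At the scale of the standard deviation the mgf bound is the absolute constant `exp (1/2)`,
  -- leaving `s^{p/2}` from rescaling.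
  set t : ℝ := (√s)⁻¹ with ht
  have ht0 : 0 < t := by positivity
  have hts : (s : ℝ) * t ^ 2 / 2 = 1 / 2 := by
    rw [ht, inv_pow, Real.sq_sqrt hs'.le, mul_inv_cancel₀ hs'.ne']
  have hpt : (p / |t|) ^ p = p ^ p * (s : ℝ) ^ (p / 2) := by
    rw [abs_of_pos ht0, ht, div_inv_eq_mul, Real.mul_rpow hp (Real.sqrt_nonneg _),
      Real.sqrt_eq_rpow, ← Real.rpow_mul hs'.le]
    ring_nf
  have hint := fun u => hX.integrable_exp_mul u
  calc ∫⁻ ω, ‖X ω‖ₑ ^ p ∂μ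
      ≤ ∫⁻ ω, ENNReal.ofReal ((p / |t|) ^ p *
          (Real.exp (t * X ω) + Real.exp (-t * X ω))) ∂μ := by
        refine lintegral_mono fun ω => ?_
        rw [← ofReal_norm, ENNReal.ofReal_rpow_of_nonneg (norm_nonneg _) hp, Real.norm_eq_abs]
        refine ENNReal.ofReal_le_ofReal
          ((rpow_abs_le_mul_max_exp (X ω) hp ht0.ne').trans ?_)
        gcongr
        exact max_le_add_of_nonneg (Real.exp_nonneg _) (Real.exp_nonneg _)
    _ = ENNReal.ofReal ((p / |t|) ^ p * (mgf X μ t + mgf X μ (-t))) := by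
        have hsum : Integrable (fun ω => Real.exp (t * X ω) + Real.exp (-t * X ω)) μ :=
          (hint t).add (hint (-t))
        rw [← ofReal_integral_eq_lintegral_ofReal (hsum.const_mul _)
          (.of_forall fun ω => by positivity), integral_const_mul,
          integral_add (hint t) (hint (-t))]
        rfl
    _ ≤ _ := by
        refine ENNReal.ofReal_le_ofReal ?_
        have h1 := hX.mgf_le t
        have h2 := hX.mgf_le (-t)
        rw [neg_sq] at h2
        rw [hts] at h1 h2
        rw [hpt]
        have : 0 ≤ p ^ p * (s : ℝ) ^ (p / 2) := by positivity
        nlinarith [mul_le_mul_of_nonneg_left (add_le_add h1 h2) this]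

variable {α : Type*} [MeasurableSpace α]

open ProbabilityTheory in
-- Hoeffding's lemma on `[-1, 1]` gives each centred term variance proxy `1`, and proxies add under
-- independence.
lemma hasSubgaussianMGF_sum_sub_mean (σ : Measure α) [IsProbabilityMeasure σ] {f : α → ℝ}
    (hf : Measurable f) (hf1 : ∀ a, |f a| ≤ 1) (N : ℕ) :
    HasSubgaussianMGF (fun ω : Fin N → α => ∑ i, f (ω i) - N * ∫ a, f a ∂σ) N
      (Measure.pi fun _ => σ) := by
  have hmean : ∀ i : Fin N, ∫ ω : Fin N → α, f (ω i) ∂(Measure.pi fun _ => σ) = ∫ a, f a ∂σ :=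
    fun i => integral_comp_eval (μ := fun _ : Fin N => σ) (i := i) hf.aestronglyMeasurable
  have hind : iIndepFun (fun (i : Fin N) (ω : Fin N → α) => f (ω i) - ∫ a, f a ∂σ)
      (Measure.pi fun _ => σ) :=
    iIndepFun_pi (X := fun _ a => f a - ∫ a, f a ∂σ) fun _ => by fun_prop
  have hsub : ∀ i ∈ (Finset.univ : Finset (Fin N)),
      HasSubgaussianMGF (fun ω : Fin N → α => f (ω i) - ∫ a, f a ∂σ) 1
        (Measure.pi fun _ => σ) := by
    intro i _
    have h := hasSubgaussianMGF_of_mem_Icc (μ := Measure.pi fun _ : Fin N => σ)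
      (X := fun ω => f (ω i)) (a := -1) (b := 1) (hf.comp (measurable_pi_apply i)).aemeasurable
      (.of_forall fun ω => abs_le.1 (hf1 (ω i)))
    rw [hmean] at h
    convert! h
    norm_num
  have h := HasSubgaussianMGF.sum_of_iIndepFun hind hsub
  simpa using h

/-- A moment bound of Marcinkiewicz–Zygmund type for sums of independent samples. -/
lemma lintegral_rpow_enorm_sum_sub_mean_le (σ : Measure α) [IsProbabilityMeasure σ] {f : α → ℂ}
    (hf : Measurable f) (hf1 : ∀ a, ‖f a‖ ≤ 1) {N : ℕ} (hN : 0 < N) {p : ℝ} (hp : 1 ≤ p) :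
    ∫⁻ ω : Fin N → α, ‖∑ i, f (ω i) - N * ∫ a, f a ∂σ‖ₑ ^ p ∂(Measure.pi fun _ => σ) ≤
      ENNReal.ofReal (2 ^ p * (2 * Real.exp (1 / 2) * p ^ p * (N : ℝ) ^ (p / 2))) := by
  have hp0 : 0 ≤ p := by linarith
  have hint : Integrable f σ :=
    Integrable.of_bound hf.aestronglyMeasurable 1 (.of_forall hf1)
  have hre : ∀ ω : Fin N → α, (∑ i, f (ω i) - N * ∫ a, f a ∂σ).re =
      ∑ i, (f (ω i)).re - N * ∫ a, (f a).re ∂σ := fun ω => by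
    have : (∫ a, f a ∂σ).re = ∫ a, (f a).re ∂σ := (integral_re hint).symm
    simp [← this]
  have him : ∀ ω : Fin N → α, (∑ i, f (ω i) - N * ∫ a, f a ∂σ).im =
      ∑ i, (f (ω i)).im - N * ∫ a, (f a).im ∂σ := fun ω => by
    have : (∫ a, f a ∂σ).im = ∫ a, (f a).im ∂σ := (integral_im hint).symm
    simp [← this]
  have hbre := lintegral_rpow_enorm_le_of_hasSubgaussianMGF (by exact_mod_cast hN)
    (hasSubgaussianMGF_sum_sub_mean σ (f := fun a => (f a).re) (by fun_prop)
      (fun a => (Complex.abs_re_le_norm _).trans (hf1 a)) N) hp0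
  have hbim := lintegral_rpow_enorm_le_of_hasSubgaussianMGF (by exact_mod_cast hN)
    (hasSubgaussianMGF_sum_sub_mean σ (f := fun a => (f a).im) (by fun_prop)
      (fun a => (Complex.abs_im_le_norm _).trans (hf1 a)) N) hp0
  simp only [NNReal.coe_natCast] at hbre hbim
  set B := 2 * Real.exp (1 / 2) * p ^ p * (N : ℝ) ^ (p / 2)
  have hB : 0 ≤ B := by positivity
  clear_value B
  -- Reduction to real variables: this factor, times the two equal bounds for the parts, produces
  -- the final `2^p`.
  have hle : ∀ z : ℂ, ‖z‖ₑ ^ p ≤ 2 ^ (p - 1) * (‖z.re‖ₑ ^ p + ‖z.im‖ₑ ^ p) := by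
    intro z
    refine le_trans (ENNReal.rpow_le_rpow ?_ hp0) (ENNReal.rpow_add_le_mul_rpow_add_rpow _ _ hp)
    rw [← ofReal_norm, ← ofReal_norm, ← ofReal_norm,
      ← ENNReal.ofReal_add (norm_nonneg _) (norm_nonneg _)]
    exact ENNReal.ofReal_le_ofReal (Complex.norm_le_abs_re_add_abs_im z)
  calc _ ≤ ∫⁻ ω : Fin N → α, 2 ^ (p - 1) * (‖∑ i, (f (ω i)).re - N * ∫ a, (f a).re ∂σ‖ₑ ^ p +
          ‖∑ i, (f (ω i)).im - N * ∫ a, (f a).im ∂σ‖ₑ ^ p) ∂(Measure.pi fun _ => σ) := by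
        refine lintegral_mono fun ω => (hle _).trans_eq ?_
        rw [hre, him]
    _ ≤ 2 ^ (p - 1) * (ENNReal.ofReal B + ENNReal.ofReal B) := by
        rw [lintegral_const_mul' _ _ (by finiteness), lintegral_add_left (by fun_prop)]
        gcongr
    _ = _ := by
        rw [← ENNReal.ofReal_add hB hB, ← two_mul, ENNReal.ofReal_mul (by norm_num),
          ENNReal.ofReal_mul (by positivity), ← mul_assoc,
          ← ENNReal.ofReal_rpow_of_pos (by norm_num)]
        congr 1
        rw [ENNReal.ofReal_ofNat]
        nth_rewrite 2 [← ENNReal.rpow_one 2]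
        rw [← ENNReal.rpow_add _ _ (by norm_num) (by norm_num)]
        simp

/-! ### Random sampling, and measure to tight sets. -/

/-- A single sample is trivially injective, so atoms matter only for `N > 1`. This form covers `d =
0`, where `σ` is a point mass. -/
lemma ae_pi_injective [MeasurableEq α]
    (σ : Measure α) [IsProbabilityMeasure σ] {N : ℕ}
    (hσ : 1 < N → ∀ a, σ {a} = 0) :
    ∀ᵐ ω ∂(Measure.pi fun _ : Fin N => σ), Function.Injective ω := by
  have hpair : ∀ i j : Fin N, i ≠ j → ∀ᵐ ω ∂(Measure.pi fun _ : Fin N => σ), ω i ≠ ω j := by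
    intro i j hij
    obtain ⟨n, rfl⟩ : ∃ n, N = n + 1 := ⟨N - 1, by have := i.2; omega⟩
    obtain ⟨k, rfl⟩ := Fin.exists_succAbove_eq hij.symm
    have hN : 1 < n + 1 := by have := k.2; omega
    -- Splitting off coordinate `i` and fixing its value `a`, a collision forces another coordinate
    -- into the null set `{a}`.
    have hmp := measurePreserving_piFinSuccAbove (fun _ : Fin (n + 1) => σ) i
    have hset : MeasurableSet {z : α × (Fin n → α) | z.1 = z.2 k} :=
      measurableSet_eq_fun measurable_fst ((measurable_pi_apply k).comp measurable_snd)
    have hnull : (σ.prod (Measure.pi fun _ : Fin n => σ)) {z | z.1 = z.2 k} = 0 := by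
      rw [Measure.measure_prod_null hset]
      refine .of_forall fun a => ?_
      have : Prod.mk a ⁻¹' {z : α × (Fin n → α) | z.1 = z.2 k} =
          Function.eval k ⁻¹' ({a} : Set α) := by
        ext ω; simp [eq_comm]
      simp only [this]
      rw [Measure.pi_eval_preimage_null (fun _ : Fin n => σ) (hσ hN a)]
      rfl
    have h := hmp.measure_preimage hset.nullMeasurableSet
    rw [hnull] at h
    rw [ae_iff]
    convert! h using 2
    ext ω
    simp [MeasurableEquiv.piFinSuccAbove, Fin.insertNthEquiv, Fin.removeNth]
  have hall : ∀ᵐ ω ∂(Measure.pi fun _ : Fin N => σ), ∀ i j : Fin N, i ≠ j → ω i ≠ ω j := by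
    simp only [ae_all_iff]
    exact hpair
  filter_upwards [hall] with ω hω i j hij
  by_contra hne
  exact hω i j hne hij

/-- Random sampling: some `N` distinct points of the support of `σ` have an exponential sum that is
close to `N σ̂` in `L^p` on `B(0,R)`. -/
lemma exists_finset_lintegral_expSum_sub_le (σ : Measure (EuclideanSpace ℝ (Fin d)))
    [IsProbabilityMeasure σ] {N : ℕ} (hN : 0 < N) (hσ : 1 < N → ∀ ξ, σ {ξ} = 0)
    {p : ℝ} (hp : 1 ≤ p) (R : ℝ) :
    ∃ P : Finset (EuclideanSpace ℝ (Fin d)), (P : Set _) ⊆ σ.support ∧ P.card = N ∧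
      ∫⁻ x in closedBall (0 : EuclideanSpace ℝ (Fin d)) R,
          ‖expSum P (fun _ => 1) x - N * fourierMeasure σ x‖ₑ ^ p ≤
        ENNReal.ofReal (2 ^ p * (2 * Real.exp (1 / 2) * p ^ p * (N : ℝ) ^ (p / 2))) *
          volume (closedBall (0 : EuclideanSpace ℝ (Fin d)) R) := by
  set μ : Measure (Fin N → EuclideanSpace ℝ (Fin d)) := Measure.pi fun _ => σ
  set F : (Fin N → EuclideanSpace ℝ (Fin d)) → EuclideanSpace ℝ (Fin d) → ENNReal := fun ω x =>
    ‖∑ i, e ⟪ω i, x⟫ - N * fourierMeasure σ x‖ₑ ^ p with hF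
  have hFm : Measurable (Function.uncurry F) := by
    have hc := continuous_fourierMeasure σ
    have : Continuous fun z : (Fin N → EuclideanSpace ℝ (Fin d)) × EuclideanSpace ℝ (Fin d) =>
        ∑ i, e ⟪z.1 i, z.2⟫ - N * fourierMeasure σ z.2 := by fun_prop
    exact this.measurable.enorm.pow_const p
  have hmean : ∫⁻ ω, (∫⁻ x in closedBall (0 : EuclideanSpace ℝ (Fin d)) R, F ω x) ∂μ ≤
      ENNReal.ofReal (2 ^ p * (2 * Real.exp (1 / 2) * p ^ p * (N : ℝ) ^ (p / 2))) *
        volume (closedBall (0 : EuclideanSpace ℝ (Fin d)) R) := by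
    rw [lintegral_lintegral_swap hFm.aemeasurable, ← setLIntegral_const]
    refine lintegral_mono fun x => ?_
    exact lintegral_rpow_enorm_sum_sub_mean_le σ (f := fun ξ => e ⟪ξ, x⟫)
      (Continuous.measurable (by fun_prop)) (fun ξ => (norm_e _).le) hN hp
  have hsupp : ∀ᵐ ω ∂μ, ∀ i, ω i ∈ σ.support := ae_all_iff.2 fun i =>
    (measurePreserving_eval (fun _ : Fin N => σ) i).quasiMeasurePreserving.ae
      Measure.support_mem_ae
  -- Some sample does no worse than the mean while avoiding the null set of samples with repeated
  -- points or points off the support.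
  obtain ⟨ω, hω, hle⟩ := exists_notMem_null_le_lintegral (μ := μ)
    (hFm.lintegral_prod_right' (ν := volume.restrict (closedBall 0 R))).aemeasurable
    (ae_iff.1 ((ae_pi_injective σ hσ).and hsupp))
  obtain ⟨hinj, hmem⟩ := not_not.1 hω
  refine ⟨Finset.univ.map ⟨ω, hinj⟩, ?_, by simp, ?_⟩
  · intro ξ hξ
    simp only [Finset.coe_map, Set.mem_image] at hξ
    obtain ⟨i, -, rfl⟩ := hξ
    exact hmem i
  · refine le_trans (le_of_eq (lintegral_congr fun x => ?_)) (hle.trans hmean)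
    simp [expSum, hF]

lemma exists_hasTightPoints_of_decay {E : Set (EuclideanSpace ℝ (Fin d))} {p : ℝ} (hp : 1 ≤ p)
    {σ : Measure (EuclideanSpace ℝ (Fin d))} (hσ : SupportsWithDecay E p σ) :
    ∃ K > (0 : ℝ), ∀ R : ℝ, 1 ≤ R → HasTightPoints E p 1 2 K R := by
  have := hσ.isProbabilityMeasure
  have hp0 : 0 < p := by linarith
  set v := volume (closedBall (0 : EuclideanSpace ℝ (Fin d)) 1) with hv
  set A := ∫⁻ x, ‖fourierMeasure σ x‖ₑ ^ p with hA
  have hv0 : v ≠ 0 := (measure_closedBall_pos _ _ one_pos).ne'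
  have hvt : v ≠ ⊤ := measure_closedBall_lt_top.ne
  set L := (A / v).toReal with hL
  have hAL : A = ENNReal.ofReal L * v := by
    rw [hL, ENNReal.ofReal_toReal (ENNReal.div_ne_top hσ.decay.ne hv0),
      ENNReal.div_mul_cancel hv0 hvt]
  set B := 2 ^ p * (2 * Real.exp (1 / 2) * p ^ p) with hB
  have hB0 : 0 < B := by positivity
  have hL0 : 0 ≤ L := ENNReal.toReal_nonneg
  -- `B` bounds the fluctuation, `2^{p/2} L` the bias, and `2^{p-1}` is the price of separating
  -- them.
  refine ⟨2 ^ (p - 1) * (B + 2 ^ (p / 2) * L), by positivity, fun R hR => ?_⟩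
  have hR0 : 0 < R := by linarith
  set T := R ^ (2 * (d : ℝ) / p) with hT
  have hT1 : 1 ≤ T := Real.one_le_rpow hR (by positivity)
  -- Since `T ≥ 1`, rounding up keeps `T ≤ N ≤ 2T`, hence the constants `1` and `2`.
  set N := ⌈T⌉₊ with hN
  have hN0 : 0 < N := Nat.ceil_pos.2 (by linarith)
  have hTN : T ≤ N := Nat.le_ceil T
  have hNT : (N : ℝ) ≤ 2 * T := by
    have := Nat.ceil_lt_add_one (show 0 ≤ T by linarith)
    linarith
  -- For `d = 0` one has `T = 1`, so `N = 1` and nothing is required.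
  have hatom : 1 < N → ∀ ξ, σ {ξ} = 0 := fun h ξ => by
    refine measure_singleton_eq_zero_of_decay (Nat.pos_of_ne_zero ?_) σ hp hσ.decay ξ
    rintro rfl
    simp [hN, hT] at h
  obtain ⟨P, hPE, hcard, hP⟩ := exists_finset_lintegral_expSum_sub_le σ hN0 hatom hp R
  refine ⟨P, hPE.trans hσ.support_subset, by simpa [hcard] using hTN,
    by simpa [hcard] using hNT, ?_⟩
  rw [sqrtCancellation_one_iff P hp0.le hR0 (by positivity), hcard]
  set V := volume (closedBall (0 : EuclideanSpace ℝ (Fin d)) R) with hV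
  have hVv : V = ENNReal.ofReal (R ^ d) * v := volume_closedBall_zero_eq hR0.le
  -- Here the exponent `2d/p` is used: `N^{p/2} ≤ (2T)^{p/2} = 2^{p/2} R^d`.
  have hNp : (N : ℝ) ^ p ≤ (N : ℝ) ^ (p / 2) * 2 ^ (p / 2) * R ^ d := by
    have h1 : (N : ℝ) ^ p = (N : ℝ) ^ (p / 2) * (N : ℝ) ^ (p / 2) := by
      rw [← Real.rpow_add (by positivity)]; ring_nf
    have h2 : T ^ (p / 2) = R ^ d := by
      rw [hT, ← Real.rpow_mul hR0.le, ← Real.rpow_natCast R d]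
      congr 1
      field_simp
    rw [h1, mul_assoc, ← h2, ← Real.mul_rpow (x := 2) (y := T) (by norm_num) (by linarith)]
    gcongr
  have hbias : ∫⁻ x in closedBall (0 : EuclideanSpace ℝ (Fin d)) R,
      ‖(N : ℂ) * fourierMeasure σ x‖ₑ ^ p ≤
      ENNReal.ofReal (2 ^ (p / 2) * L * (N : ℝ) ^ (p / 2)) * V := by
    calc ∫⁻ x in closedBall (0 : EuclideanSpace ℝ (Fin d)) R,
          ‖(N : ℂ) * fourierMeasure σ x‖ₑ ^ p
        ≤ ∫⁻ x, ‖(N : ℂ) * fourierMeasure σ x‖ₑ ^ p := setLIntegral_le_lintegral _ _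
      _ = ENNReal.ofReal ((N : ℝ) ^ p) * A := by
          rw [hA, ← lintegral_const_mul' _ _ ENNReal.ofReal_ne_top]
          refine lintegral_congr fun x => ?_
          rw [enorm_mul, ENNReal.mul_rpow_of_nonneg _ _ hp0.le,
            ← ENNReal.ofReal_rpow_of_nonneg (by positivity) hp0.le, ← ofReal_norm]
          simp
      _ ≤ ENNReal.ofReal ((N : ℝ) ^ (p / 2) * 2 ^ (p / 2) * R ^ d) * A := by gcongr
      _ = _ := by
          rw [hAL, hVv, ← mul_assoc, ← mul_assoc, ← ENNReal.ofReal_mul (by positivity),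
            ← ENNReal.ofReal_mul (by positivity)]
          ring_nf
  have hcont : Continuous fun x => expSum P (fun _ => 1) x - N * fourierMeasure σ x :=
    (continuous_expSum P _).sub (continuous_const.mul (continuous_fourierMeasure σ))
  calc ∫⁻ x in closedBall (0 : EuclideanSpace ℝ (Fin d)) R, ‖expSum P (fun _ => 1) x‖ₑ ^ p
      ≤ ∫⁻ x in closedBall (0 : EuclideanSpace ℝ (Fin d)) R, 2 ^ (p - 1) *
          (‖expSum P (fun _ => 1) x - N * fourierMeasure σ x‖ₑ ^ p +
            ‖(N : ℂ) * fourierMeasure σ x‖ₑ ^ p) := by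
        refine lintegral_mono fun x => ?_
        refine le_trans (ENNReal.rpow_le_rpow ?_ hp0.le)
          (ENNReal.rpow_add_le_mul_rpow_add_rpow _ _ hp)
        simpa using enorm_add_le (expSum P (fun _ => 1) x - N * fourierMeasure σ x)
          (N * fourierMeasure σ x)
    _ ≤ 2 ^ (p - 1) * (ENNReal.ofReal (B * (N : ℝ) ^ (p / 2)) * V +
          ENNReal.ofReal (2 ^ (p / 2) * L * (N : ℝ) ^ (p / 2)) * V) := by
        rw [lintegral_const_mul' _ _ (by finiteness),
          lintegral_add_left (hcont.measurable.enorm.pow_const p)]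
        gcongr
        refine hP.trans_eq ?_
        rw [hB, mul_assoc (2 ^ p)]
    _ = _ := by
        rw [← add_mul, ← ENNReal.ofReal_add (by positivity) (by positivity), ← add_mul,
          ← mul_assoc, mul_assoc (2 ^ (p - 1)) (B + _), ENNReal.ofReal_mul (p := 2 ^ (p - 1))
          (by positivity), ← ENNReal.ofReal_rpow_of_pos (by norm_num), ENNReal.ofReal_ofNat]

end TightDecoupling

theorem theorem4p2 (d : ℕ) (p : ℝ) (hp : 2 ≤ p) (E : Set (EuclideanSpace ℝ (Fin d)))
    (hE : IsCompact E) :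
    (∀ σ : Measure (EuclideanSpace ℝ (Fin d)),
      TightDecoupling.SupportsWithDecay E p σ → TightDecoupling.HasFineEqualPartitions σ →
      ∃ c > (0 : ℝ), ∃ C > (0 : ℝ), ∃ K > (0 : ℝ), ∃ R₀ > (0 : ℝ),
        ∀ R : ℝ, R₀ ≤ R → TightDecoupling.HasTightPoints E p c C K R) ∧
    (∀ R : ℕ → ℝ, Tendsto R atTop atTop →
      (∃ c > (0 : ℝ), ∃ C > (0 : ℝ), ∃ K > (0 : ℝ),
        ∀ k : ℕ, TightDecoupling.HasTightPoints E p c C K (R k)) →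
      ∃ σ : Measure (EuclideanSpace ℝ (Fin d)), TightDecoupling.SupportsWithDecay E p σ) := by
  refine ⟨fun σ hσ _ => ?_, fun R hR h => ?_⟩
  · obtain ⟨K, hK, h⟩ := TightDecoupling.exists_hasTightPoints_of_decay (by linarith) hσ
    exact ⟨1, one_pos, 2, two_pos, K, hK, 1, one_pos, h⟩
  · obtain ⟨c, hc, C, _, K, hK, h⟩ := h
    exact TightDecoupling.exists_supportsWithDecay_of_hasTightPoints hE (by linarith) hR hc hK.le h
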